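/- Let $p$ and $q$ be distinct primes with $p\equiv q\equiv 1 \pmod 4$. For a prime $\ell\equiv 1\pmod 4$ and an integer $a$ that is a nonzero square modulo $\ell$, let $\left(\frac{a}{\ell}\right)_4=1$ if $a$ is a fourth power modulo $\ell$, and $\left(\frac{a}{\ell}\right)_4=-1$ otherwise. Suppose that $\left(\frac{q}{p}\right)=1$ (Legendre symbol; hence also $\left(\frac{p}{q}\right)=1$ by quadratic reciprocity) and that $\left(\frac{p}{q}\right)_4\left(\frac{q}{p}\right)_4=-1$. Then the equation $x^2-pqy^2=-1$ has no solution in integers $x,y$, and the equation $x^2-pqy^2=p$ has a solution in integers $x,y$ if and only if $\left(\frac{q}{p}\right)_4=1$. -/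

import Mathlib

open Classical in
/-- The rational quartic residue symbol `(a/p)₄`, for a prime `p ≡ 1 mod 4` and an integer `a`
that is a nonzero square modulo `p`: it is `1` if `a` is a fourth power modulo `p` and `-1`
otherwise. Where the symbol is not defined (`a` zero or a non-square modulo `p`) it takes the
value `0`. -/
noncomputable def quarticSymbol (p : ℕ) (a : ℤ) : ℤ :=
  if (a : ZMod p) ≠ 0 ∧ IsSquare (a : ZMod p) then
    if ∃ x : ZMod p, x ^ 4 = (a : ZMod p) then 1 else -1
  else 0

/-!
The proof is elementary and rests on the conic `p * a ^ 2 - q * b ^ 2 = c ^ 2`.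

If `(a, b, c)` is a point on it with `a`, `b` coprime, then modulo `p` it gives
`q ≡ -(c / b) ^ 2`. As `-1` is a square modulo `p` and twice a square root of `-1` is a square, this
means `(q/p)₄ = (2 b c / p)` (`quarticSymbol_eq_legendreSym`). Quadratic reciprocity, together with
`p * a ^ 2 ≡ c ^ 2` modulo `b`, removes `b`: the symbol is `(c/p)` for odd `c` and `(2 c / p)` for
even `c` (`quarticSymbol_eq_of_conic`). With `c = 1` this shows that `p * a ^ 2 - q * b ^ 2 = 1`
forces `(q/p)₄ = 1`.

Suppose `x ^ 2 - p q y ^ 2 = -1`. The conic has a point `(a, b, c)`, found by a pigeonhole argument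
(`exists_conic_point`). Multiplying `p a + b √(pq)` by `x + y √(pq)` turns it into a point of the
conic with `p` and `q` interchanged and with the same `c`. Hence `(q/p)₄ (p/q)₄` is `(c / pq)` or
`(2 c / pq)`, and this is `1` because `p q` is a square modulo `c`
(`quarticSymbol_mul_eq_one_of_neg_pell`). So the hypothesis on the quartic symbols rules out the
negative Pell equation.

Finally, factoring `(x - 1) (x + 1) = p q y ^ 2` for the fundamental solution of the Pell equation
shows that one of `x ^ 2 - p q y ^ 2 = -1`, `p a ^ 2 - q b ^ 2 = 1`, `q a ^ 2 - p b ^ 2 = 1` is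
solvable (`exists_solution_of_prime_mul_prime`). The first is impossible, and the other two force
`(q/p)₄ = 1` and `(p/q)₄ = 1` respectively, so exactly one of them is solvable and the symbols tell
which. The second equation is `x ^ 2 - p q y ^ 2 = p` after dividing by `p`, since `p ∣ x`.
-/

/-! ### The quartic symbol as a quadratic symbol -/

/-- If `q ≡ -(c / b) ^ 2` modulo `p`, then `q` is the square of `r = i * c / b` with `i ^ 2 = -1`, so
`q` is a fourth power exactly when `r` is a square; and `i` is a square exactly when `2` is, because
`(1 + i) ^ 2 = 2 * i`. -/
theorem quarticSymbol_eq_legendreSym {p : ℕ} [Fact p.Prime] (hp : p % 4 = 1) {q b c : ℤ}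
    (hc : ¬ (p : ℤ) ∣ c) (h : (p : ℤ) ∣ c ^ 2 + q * b ^ 2) :
    quarticSymbol p q = legendreSym p (2 * b * c) := by
  have hc' : (c : ZMod p) ≠ 0 := by rwa [Ne, ZMod.intCast_zmod_eq_zero_iff_dvd]
  have h' : (c : ZMod p) ^ 2 + q * b ^ 2 = 0 := by
    have := (ZMod.intCast_zmod_eq_zero_iff_dvd _ p).mpr h
    simpa using this
  have hb' : (b : ZMod p) ≠ 0 := by
    intro h0; rw [h0] at h'; apply hc'; simpa using h'
  have hq' : (q : ZMod p) ≠ 0 := by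
    intro h0; rw [h0] at h'; apply hc'; simpa using h'
  have hp2 : p ≠ 2 := by rintro rfl; omega
  have h2 : (2 : ZMod p) ≠ 0 := by
    have := ZMod.prime_ne_zero p 2 hp2
    exact_mod_cast this
  obtain ⟨i, hi⟩ : IsSquare (-1 : ZMod p) := ZMod.exists_sq_eq_neg_one_iff.mpr (by omega)
  set r : ZMod p := i * c / b with hr
  have hqr : (q : ZMod p) = r ^ 2 := by
    rw [hr]; field_simp
    linear_combination h' + (c : ZMod p) ^ 2 * hi
  have hr0 : r ≠ 0 := by rintro h0; apply hq'; rw [hqr, h0]; ring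
  have hfour : (∃ x : ZMod p, x ^ 4 = (q : ZMod p)) ↔ IsSquare r := by
    constructor
    · rintro ⟨x, hx⟩
      have : (x ^ 2 - r) * (x ^ 2 + r) = 0 := by linear_combination hx + hqr
      rcases mul_eq_zero.mp this with h3 | h3
      · exact ⟨x, by linear_combination -h3⟩
      -- `-1` is a square, so `r` and `-r` are squares together.
      · exact ⟨i * x, by linear_combination h3 + x ^ 2 * hi⟩
    · rintro ⟨x, hx⟩
      exact ⟨x, by rw [hqr, hx]; ring⟩
  have hsq : IsSquare r ↔ IsSquare ((2 * b * c : ℤ) : ZMod p) := by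
    -- `2 * b * c * r = (1 + i) ^ 2 * c ^ 2`, and `1 + i ≠ 0`.
    have hi1 : (1 + i) ^ 2 = 2 * i := by linear_combination -hi
    have hi0 : i ≠ 0 := by rintro rfl; simp at hi
    have hi1' : (1 + i) ≠ 0 := by
      intro h0; rw [h0] at hi1; simp at hi1; tauto
    have hprod : r * (2 * b * c) = ((1 + i) * c) ^ 2 := by
      rw [mul_pow, hi1, hr]; field_simp
    have h20 : (2 * b * c : ZMod p) ≠ 0 := by simp [h2, hb', hc']
    push_cast
    constructor
    · rintro ⟨x, hx⟩
      have hx0 : x ≠ 0 := by rintro rfl; simp at hx; exact hr0 hx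
      refine ⟨(1 + i) * c / x, ?_⟩
      rw [hx] at hprod
      rw [div_mul_div_comm, eq_div_iff (mul_ne_zero hx0 hx0)]
      linear_combination hprod
    · rintro ⟨x, hx⟩
      have hx0 : x ≠ 0 := by rintro rfl; rw [mul_zero] at hx; exact h20 hx
      refine ⟨(1 + i) * c / x, ?_⟩
      rw [hx] at hprod
      rw [div_mul_div_comm, eq_div_iff (mul_ne_zero hx0 hx0)]
      linear_combination hprod
  have h20 : ((2 * b * c : ℤ) : ZMod p) ≠ 0 := by push_cast; simp [h2, hb', hc']
  unfold quarticSymbol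
  rw [if_pos ⟨hq', ⟨r, by rw [hqr]; ring⟩⟩]
  split_ifs with h4
  · exact ((legendreSym.eq_one_iff p h20).mpr (hsq.mp (hfour.mp h4))).symm
  · exact ((legendreSym.eq_neg_one_iff p).mpr fun h5 => h4 (hfour.mpr (hsq.mpr h5))).symm

/-! ### Jacobi symbols of divisors of `D * a ^ 2 - c ^ 2` -/

/-- `D` is a square modulo `b`, so quadratic reciprocity makes the symbol `(b / D)` trivial; the sign
of `b` does not matter because `D ≡ 1` modulo `4`. -/
theorem jacobiSym_eq_one_of_dvd {D : ℕ} (hD : D % 4 = 1) {a b c : ℤ} (hb : Odd b)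
    (h : b ∣ D * a ^ 2 - c ^ 2) (hab : IsCoprime a b) (hcb : IsCoprime c b) :
    jacobiSym b D = 1 := by
  have hDo : Odd D := Nat.odd_iff.mpr (by omega)
  have hbo : Odd b.natAbs := Int.natAbs_odd.mpr hb
  have hneg : jacobiSym b D = jacobiSym b.natAbs D := by
    rcases Int.natAbs_eq b with h1 | h1
    · rw [← h1]
    · conv_lhs => rw [h1]
      rw [jacobiSym.neg _ hDo, ZMod.χ₄_nat_one_mod_four hD, one_mul]
  have cop {x : ℤ} (hx : IsCoprime x b) : x.gcd (b.natAbs : ℕ) = 1 := by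
    rw [Int.isCoprime_iff_gcd_eq_one] at hx
    rw [Int.gcd_def, Int.natAbs_natCast]
    exact hx
  rw [hneg, ← jacobiSym.quadratic_reciprocity_one_mod_four hD hbo]
  have h1 : jacobiSym (D * a ^ 2) b.natAbs = jacobiSym (c ^ 2) b.natAbs := by
    apply jacobiSym.mod_left'
    apply Int.ModEq.symm
    rw [Int.modEq_iff_dvd]
    exact Int.natAbs_dvd.mpr h
  rwa [jacobiSym.mul_left, jacobiSym.sq_one' (cop hab), jacobiSym.sq_one' (cop hcb), mul_one] at h1

theorem jacobiSym_two_eq_one {D : ℕ} (hD : D % 8 = 1) : jacobiSym 2 D = 1 := by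
  rw [jacobiSym.at_two (Nat.odd_iff.mpr (by omega)), ZMod.χ₈_nat_eq_if_mod_eight]
  simp [hD]; omega

/-- The analogue of `jacobiSym_eq_one_of_dvd` for even `b`. The factor `2` in `2 * b` makes the power
of `2` a square when `b ≡ 2` modulo `4`; otherwise `(2 / D) = 1` by assumption. -/
theorem jacobiSym_two_mul_eq_one_of_dvd {D : ℕ} (hD : D % 4 = 1) {a b c : ℤ} (hb0 : b ≠ 0)
    (hb : Even b) (hD8 : 4 ∣ b → D % 8 = 1)
    (h : b ∣ D * a ^ 2 - c ^ 2) (hab : IsCoprime a b) (hcb : IsCoprime c b) :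
    jacobiSym (2 * b) D = 1 := by
  obtain ⟨k, m, hm, rfl⟩ : ∃ (k : ℕ) (m : ℤ), Odd m ∧ b = 2 ^ k * m := by
    have hfin : FiniteMultiplicity (2 : ℤ) b := Int.finiteMultiplicity_iff.mpr ⟨by decide, hb0⟩
    obtain ⟨m, hbm, hm⟩ := hfin.exists_eq_pow_mul_and_not_dvd
    exact ⟨_, m, Int.not_even_iff_odd.mp fun h2 => hm h2.two_dvd, hbm⟩
  have hm1 : jacobiSym m D = 1 :=
    jacobiSym_eq_one_of_dvd hD hm ((dvd_mul_left _ _).trans h)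
      (hab.of_isCoprime_of_dvd_right (dvd_mul_left _ _))
      (hcb.of_isCoprime_of_dvd_right (dvd_mul_left _ _))
  have e : 2 * (2 ^ k * m) = 2 ^ (k + 1) * m := by ring
  rw [e, jacobiSym.mul_left, hm1, mul_one]
  rcases k with _ | _ | k
  · exfalso
    rw [pow_zero, one_mul] at hb
    exact (Int.not_even_iff_odd.mpr hm) hb
  · exact jacobiSym.at_four (Nat.odd_iff.mpr (by omega))
  · rw [jacobiSym.pow_left, jacobiSym_two_eq_one (hD8 ⟨2 ^ k * m, by ring⟩), one_pow]

/-! ### Points on the conic `p * a ^ 2 - q * b ^ 2 = c ^ 2` -/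

theorem prime_not_dvd_of_conic {p q : ℕ} (hp : p.Prime) (hq : q.Prime) (hpq : p ≠ q) {a b c : ℤ}
    (h : p * a ^ 2 - q * b ^ 2 = c ^ 2) (hab : IsCoprime a b) : ¬ (p : ℤ) ∣ c ∧ ¬ (p : ℤ) ∣ b := by
  have hp' : Prime (p : ℤ) := Nat.prime_iff_prime_int.mp hp
  have key : ¬ (p : ℤ) ∣ b := by
    rintro ⟨b', rfl⟩
    have hc : (p : ℤ) ∣ c := hp'.dvd_of_dvd_pow (n := 2) ⟨a ^ 2 - q * p * b' ^ 2, by linarith⟩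
    obtain ⟨c', rfl⟩ := hc
    have ha : (p : ℤ) ∣ a := by
      apply hp'.dvd_of_dvd_pow (n := 2)
      refine ⟨c' ^ 2 + q * b' ^ 2, mul_left_cancel₀ hp'.ne_zero ?_⟩
      linear_combination h
    exact hp'.not_isUnit (hab.isUnit_of_dvd' ha (dvd_mul_right _ _))
  refine ⟨?_, key⟩
  rintro ⟨c', rfl⟩
  have h1 : (p : ℤ) ∣ q * b ^ 2 := ⟨a ^ 2 - p * c' ^ 2, by linarith⟩
  rcases hp'.dvd_or_dvd h1 with h2 | h2
  · exact hpq ((Nat.prime_dvd_prime_iff_eq hp hq).mp (by exact_mod_cast h2))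
  · exact key (hp'.dvd_of_dvd_pow h2)

theorem isCoprime_of_conic {p q : ℕ} (hp : p.Prime) (hq : q.Prime) (hpq : p ≠ q) {a b c : ℤ}
    (h : p * a ^ 2 - q * b ^ 2 = c ^ 2) (hab : IsCoprime a b) : IsCoprime c b := by
  have hpb : IsCoprime (p : ℤ) b := ((Nat.prime_iff_prime_int.mp hp).coprime_iff_not_dvd).mpr
    (prime_not_dvd_of_conic hp hq hpq h hab).2
  have h1 : IsCoprime (p * a ^ 2) b := hpb.mul_left (hab.pow_left)
  have h2 : IsCoprime (c ^ 2) b := by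
    rw [← h, show (p : ℤ) * a ^ 2 - q * b ^ 2 = p * a ^ 2 + b * (-(q * b)) by ring]
    exact h1.add_mul_left_left _
  exact (IsCoprime.pow_left_iff two_pos).mp h2

/-- A point on the conic with `a`, `b` coprime has `a` odd, and exactly one of `b`, `c` even; it
expresses `(q/p)₄` through the quadratic character of `c` modulo `p`. -/
theorem quarticSymbol_eq_of_conic {p q : ℕ} [hp' : Fact p.Prime] [hq' : Fact q.Prime] (hpq : p ≠ q)
    (hp : p % 4 = 1) (hq : q % 4 = 1) {a b c : ℤ}
    (h : p * a ^ 2 - q * b ^ 2 = c ^ 2) (hab : IsCoprime a b) :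
    Odd a ∧ (Even c ∧ Odd b ∧ quarticSymbol p q = jacobiSym (2 * c) p ∨
      Odd c ∧ Even b ∧ quarticSymbol p q = jacobiSym c p) := by
  obtain ⟨hpc, hpb⟩ := prime_not_dvd_of_conic hp'.out hq'.out hpq h hab
  have hcb := isCoprime_of_conic hp'.out hq'.out hpq h hab
  have hquart : quarticSymbol p q = jacobiSym (2 * b * c) p := by
    rw [← jacobiSym.legendreSym.to_jacobiSym]
    exact quarticSymbol_eq_legendreSym hp hpc ⟨a ^ 2, by linarith⟩
  have hdvd : b ∣ p * a ^ 2 - c ^ 2 := ⟨q * b, by linarith⟩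
  have hb0 : b ≠ 0 := by rintro rfl; simp at hpb
  obtain ⟨P, hP⟩ : ∃ P : ℤ, (p : ℤ) = 4 * P + 1 := ⟨p / 4, by omega⟩
  obtain ⟨Q, hQ⟩ : ∃ Q : ℤ, (q : ℤ) = 4 * Q + 1 := ⟨q / 4, by omega⟩
  have hnot : ¬ (Even a ∧ Even b) := by
    rintro ⟨h1, h2⟩
    have := hab.isUnit_of_dvd' h1.two_dvd h2.two_dvd
    exact absurd this (by decide)
  have ha : Odd a := by
    by_contra ha
    rw [Int.not_odd_iff_even] at ha
    have hb : Odd b := by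
      rw [← Int.not_even_iff_odd]; exact fun hb => hnot ⟨ha, hb⟩
    obtain ⟨A, rfl⟩ := ha
    obtain ⟨B, rfl⟩ := hb
    rcases Int.even_or_odd' c with ⟨C, rfl | rfl⟩ <;> rw [hP, hQ] at h <;> ring_nf at h <;> omega
  refine ⟨ha, ?_⟩
  rcases Int.even_or_odd b with hb | hb
  · right
    have hc : Odd c := by
      rw [← Int.not_even_iff_odd]; intro hc
      exact absurd (hcb.isUnit_of_dvd' hc.two_dvd hb.two_dvd) (by decide)
    refine ⟨hc, hb, ?_⟩
    rw [hquart, jacobiSym.mul_left, jacobiSym_two_mul_eq_one_of_dvd hp hb0 hb ?_ hdvd hab hcb,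
      one_mul]
    -- If `4 ∣ b`, the equation modulo `8` reads `p ≡ 1`.
    rintro ⟨B, rfl⟩
    obtain ⟨A, hA⟩ := Int.eight_dvd_sq_sub_one_of_odd ha
    obtain ⟨C, hC⟩ := Int.eight_dvd_sq_sub_one_of_odd hc
    have : (p : ℤ) % 8 = 1 := by
      have : (p : ℤ) = 8 * (C - p * A + 2 * q * B ^ 2) + 1 := by linear_combination h - p * hA + hC
      omega
    omega
  · left
    have hc : Even c := by
      rw [← Int.not_odd_iff_even]; intro hc
      have h1 : Odd (p * a ^ 2 - q * b ^ 2) := h ▸ hc.pow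
      have h2 : Even (p * a ^ 2 - q * b ^ 2) := by
        apply Odd.sub_odd
        · exact Odd.mul ⟨2 * P, by omega⟩ ha.pow
        · exact Odd.mul ⟨2 * Q, by omega⟩ hb.pow
      exact (Int.not_even_iff_odd.mpr h1) h2
    refine ⟨hc, hb, ?_⟩
    rw [hquart, show 2 * b * c = b * (2 * c) by ring, jacobiSym.mul_left,
      jacobiSym_eq_one_of_dvd hp hb hdvd hab hcb, one_mul]

/-- A case of Legendre's theorem, by the pigeonhole principle. Four congruences of total index
`4 * p * q` make the form `p * a ^ 2 - q * b ^ 2 - c ^ 2` divisible by `4 * p * q`, and the box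
`a ^ 2 < 4 * q`, `b ^ 2 < 2 * p`, `c ^ 2 < 2 * p * q` is just large enough to contain a nonzero
vector satisfying them, while the form is smaller than `4 * p * q` in absolute value on it. -/
theorem exists_conic_point {p q : ℕ} [hp' : Fact p.Prime] [hq' : Fact q.Prime] (hne : p ≠ q)
    (hp : p % 4 = 1) (hq : q % 4 = 1) (hqp : IsSquare (q : ZMod p)) (hpq : IsSquare (p : ZMod q)) :
    ∃ a b c : ℤ, p * a ^ 2 - q * b ^ 2 = c ^ 2 ∧ (a ≠ 0 ∨ b ≠ 0 ∨ c ≠ 0) := by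
  obtain ⟨s, hs⟩ := hpq
  obtain ⟨u, hu⟩ := hqp
  obtain ⟨i, hi⟩ : IsSquare (-1 : ZMod p) := ZMod.exists_sq_eq_neg_one_iff.mpr (by omega)
  set A := Nat.sqrt (4 * q) with hA
  set B := Nat.sqrt (2 * p) with hB
  set C := Nat.sqrt (2 * (p * q)) with hC
  have hp0 : 0 < p := hp'.out.pos
  have hq0 : 0 < q := hq'.out.pos
  have hA1 : A ^ 2 < 4 * q := by
    refine lt_of_le_of_ne (Nat.sqrt_le' _) fun h => ?_
    have h2 : Even A := by
      have : Even (A ^ 2) := ⟨2 * q, by omega⟩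
      exact (Nat.even_pow.mp this).1
    obtain ⟨A', hA'⟩ := h2
    have h3 : q = A' ^ 2 := by rw [hA'] at h; nlinarith
    exact hq'.out.prime.not_isSquare ⟨A', by rw [h3]; ring⟩
  have two_mod {m n : ℕ} (hn : n % 4 = 1) : m ^ 2 ≠ 2 * n := by
    intro h
    rcases Nat.even_or_odd' m with ⟨k, rfl | rfl⟩ <;> ring_nf at h <;> omega
  have hB1 : B ^ 2 < 2 * p := lt_of_le_of_ne (Nat.sqrt_le' _) (two_mod hp)
  have hC1 : C ^ 2 < 2 * (p * q) :=
    lt_of_le_of_ne (Nat.sqrt_le' _) (two_mod (by simp [Nat.mul_mod, hp, hq]))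
  have hcard : 4 * p * q < (A + 1) * (B + 1) * (C + 1) := by
    have hA2 : 4 * q < (A + 1) ^ 2 := Nat.lt_succ_sqrt' _
    have hB2 : 2 * p < (B + 1) ^ 2 := Nat.lt_succ_sqrt' _
    have hC2 : 2 * (p * q) < (C + 1) ^ 2 := Nat.lt_succ_sqrt' _
    refine lt_of_pow_lt_pow_left₀ 2 (by positivity) ?_
    calc (4 * p * q) ^ 2 = 4 * q * (2 * p) * (2 * (p * q)) := by ring
      _ < (A + 1) ^ 2 * (B + 1) ^ 2 * (C + 1) ^ 2 := by gcongr
      _ = _ := by ring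
  -- The kernel conditions are `c ≡ s * a` mod `q`, `c ≡ i * u * b` mod `p`, `b` even and `a ≡ c`
  -- mod `2`; the last two make the form divisible by `4`, because `p ≡ 1` mod `4`.
  let f : ℕ × ℕ × ℕ → ZMod q × ZMod p × ZMod 2 × ZMod 2 := fun v =>
    ((v.2.2 : ZMod q) - s * v.1, (v.2.2 : ZMod p) - i * u * v.2.1, (v.2.1 : ZMod 2),
      (v.1 : ZMod 2) - v.2.2)
  obtain ⟨⟨a₁, b₁, c₁⟩, h1, ⟨a₂, b₂, c₂⟩, h2, hv, heq⟩ :=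
    Finset.exists_ne_map_eq_of_card_lt_of_maps_to (f := f) (t := Finset.univ)
      (s := Finset.range (A + 1) ×ˢ Finset.range (B + 1) ×ˢ Finset.range (C + 1))
      (by simp only [Finset.card_product, Finset.card_range, Finset.card_univ, Fintype.card_prod,
            ZMod.card]
          linarith)
      (fun _ _ => Finset.mem_coe.mpr (Finset.mem_univ _))
  simp only [Finset.mem_product, Finset.mem_range] at h1 h2
  simp only [f, Prod.mk.injEq] at heq
  obtain ⟨e1, e2, e3, e4⟩ := heq
  refine ⟨(a₁ : ℤ) - a₂, (b₁ : ℤ) - b₂, (c₁ : ℤ) - c₂, ?_, ?_⟩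
  swap
  · by_contra! h
    apply hv
    simp only [Prod.mk.injEq]
    omega
  have bd {m n M : ℕ} (hm : m < M + 1) (hn : n < M + 1) : ((m : ℤ) - n) ^ 2 ≤ (M : ℤ) ^ 2 := by
    apply sq_le_sq'
    all_goals omega
  have ba := bd h1.1 h2.1
  have bb := bd h1.2.1 h2.2.1
  have bc := bd h1.2.2 h2.2.2
  set a : ℤ := (a₁ : ℤ) - a₂ with ha
  set b : ℤ := (b₁ : ℤ) - b₂ with hb
  set c : ℤ := (c₁ : ℤ) - c₂ with hc
  have dq : (q : ℤ) ∣ p * a ^ 2 - q * b ^ 2 - c ^ 2 := by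
    rw [← ZMod.intCast_zmod_eq_zero_iff_dvd]
    have : (c : ZMod q) = s * a := by rw [ha, hc]; push_cast; linear_combination e1
    push_cast
    rw [this, ZMod.natCast_self, hs]
    ring
  have dp : (p : ℤ) ∣ p * a ^ 2 - q * b ^ 2 - c ^ 2 := by
    rw [← ZMod.intCast_zmod_eq_zero_iff_dvd]
    have : (c : ZMod p) = i * u * b := by rw [hb, hc]; push_cast; linear_combination e2
    push_cast
    rw [this, ZMod.natCast_self, hu]
    linear_combination (u * b) ^ 2 * hi
  have d4 : (4 : ℤ) ∣ p * a ^ 2 - q * b ^ 2 - c ^ 2 := by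
    have h1 : ((2 : ℕ) : ℤ) ∣ b := by
      rw [← ZMod.intCast_zmod_eq_zero_iff_dvd, hb]; push_cast; linear_combination e3
    have h2 : ((2 : ℕ) : ℤ) ∣ a - c := by
      rw [← ZMod.intCast_zmod_eq_zero_iff_dvd, ha, hc]; push_cast; linear_combination e4
    obtain ⟨b', hb'⟩ := h1
    obtain ⟨k, hk⟩ := h2
    obtain ⟨P, hP⟩ : ∃ P : ℤ, (p : ℤ) = 4 * P + 1 := ⟨p / 4, by omega⟩
    refine ⟨P * a ^ 2 - q * b' ^ 2 + k * (c + k), ?_⟩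
    have hk' : a = c + 2 * k := by push_cast at hk; linarith
    rw [hP, hb', hk']; push_cast; ring
  have cop1 : IsCoprime (p : ℤ) q :=
    Nat.isCoprime_iff_coprime.mpr ((Nat.coprime_primes hp'.out hq'.out).mpr hne)
  have cop2 : IsCoprime (4 : ℤ) (p * q) := by
    have : Nat.Coprime 4 (p * q) := by
      rw [show 4 = 2 ^ 2 by norm_num]
      apply Nat.Coprime.pow_left
      rw [Nat.coprime_two_left, Nat.odd_iff, Nat.mul_mod]
      have h1 : p % 2 = 1 := by omega
      have h2 : q % 2 = 1 := by omega
      simp [h1, h2]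
    exact_mod_cast Nat.isCoprime_iff_coprime.mpr this
  have hd := cop2.mul_dvd d4 (cop1.mul_dvd dp dq)
  have hzero := Int.eq_zero_of_abs_lt_dvd hd (by
    zify at hA1 hB1 hC1
    have hp0' : (0 : ℤ) < p := by exact_mod_cast hp0
    have hq0' : (0 : ℤ) < q := by exact_mod_cast hq0
    have t1 : (p : ℤ) * a ^ 2 < p * (4 * q) := by
      apply mul_lt_mul_of_pos_left _ hp0'; linarith
    have t2 : (q : ℤ) * b ^ 2 < q * (2 * p) := by
      apply mul_lt_mul_of_pos_left _ hq0'; linarith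
    have t3 : 0 ≤ (p : ℤ) * a ^ 2 := by positivity
    have t4 : 0 ≤ (q : ℤ) * b ^ 2 := by positivity
    rw [abs_lt]
    constructor <;> nlinarith [sq_nonneg c])
  linarith

theorem exists_coprime_conic_point {p q : ℕ} [hp' : Fact p.Prime] [hq' : Fact q.Prime] (hne : p ≠ q)
    (hp : p % 4 = 1) (hq : q % 4 = 1) (hqp : IsSquare (q : ZMod p)) (hpq : IsSquare (p : ZMod q)) :
    ∃ a b c : ℤ, p * a ^ 2 - q * b ^ 2 = c ^ 2 ∧ IsCoprime a b := by
  obtain ⟨a, b, c, h, h0⟩ := exists_conic_point hne hp hq hqp hpq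
  have hg : 0 < Int.gcd a b := by
    rw [Int.gcd_pos_iff]
    by_contra! hab
    obtain ⟨rfl, rfl⟩ := hab
    simp at h h0
    exact h0 (by simpa using h.symm)
  obtain ⟨a', b', hcop, ha, hb⟩ := Int.exists_gcd_one hg
  set g : ℤ := (Int.gcd a b : ℤ) with hgdef
  have hg' : g ≠ 0 := by positivity
  have : g ∣ c := by
    rw [← Int.pow_dvd_pow_iff two_ne_zero]
    exact ⟨p * a' ^ 2 - q * b' ^ 2, by rw [← h, ha, hb]; ring⟩
  obtain ⟨c', rfl⟩ := this
  refine ⟨a', b', c', ?_, Int.isCoprime_iff_gcd_eq_one.mpr hcop⟩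
  apply mul_left_cancel₀ (pow_ne_zero 2 hg')
  rw [ha, hb] at h
  linear_combination h

/-! ### The negative Pell equation -/

/-- A solution of `x ^ 2 - p * q * y ^ 2 = -1` carries a point `(a, b, c)` of the conic to a point
of the conic with `p` and `q` interchanged, with the same `c`; so both quartic symbols are
evaluated through the same `c`. -/
theorem quarticSymbol_mul_eq_one_of_neg_pell {p q : ℕ} [hp' : Fact p.Prime] [hq' : Fact q.Prime]
    (hne : p ≠ q) (hp : p % 4 = 1) (hq : q % 4 = 1) (hqp : IsSquare (q : ZMod p))
    (hpq : IsSquare (p : ZMod q)) {x y : ℤ} (h : x ^ 2 - p * q * y ^ 2 = -1) :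
    quarticSymbol q p * quarticSymbol p q = 1 := by
  obtain ⟨a, b, c, hc, hab⟩ := exists_coprime_conic_point hne hp hq hqp hpq
  have hc' : q * (p * a * y + b * x) ^ 2 - p * (a * x + q * b * y) ^ 2 = c ^ 2 := by
    linear_combination hc - (p * a ^ 2 - q * b ^ 2) * h
  have hab' : IsCoprime (p * a * y + b * x) (a * x + q * b * y) := by
    obtain ⟨u, v, huv⟩ := hab
    exact ⟨u * (q * y) - v * x, v * (p * y) - u * x, by
      linear_combination huv - (u * a + v * b) * h⟩
  obtain ⟨ha, h1⟩ := quarticSymbol_eq_of_conic hne hp hq hc hab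
  obtain ⟨-, h2⟩ := quarticSymbol_eq_of_conic hne.symm hq hp hc' hab'
  have hpc := (prime_not_dvd_of_conic hp'.out hq'.out hne hc hab).1
  have hqc := (prime_not_dvd_of_conic hq'.out hp'.out hne.symm hc' hab').1
  have hcb := isCoprime_of_conic hp'.out hq'.out hne hc hab
  have hdvd : c ∣ (p * q : ℕ) * b ^ 2 - (p * a) ^ 2 :=
    ⟨-(p * c), by push_cast; linear_combination (-p : ℤ) * hc⟩
  have hcop : IsCoprime (p * a) c := by
    have h3 : IsCoprime (q * b ^ 2) c :=
      ((Nat.prime_iff_prime_int.mp hq'.out).coprime_iff_not_dvd.mpr hqc).mul_left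
        hcb.symm.pow_left
    have h4 : IsCoprime (p * a ^ 2) c := by
      rw [show (p : ℤ) * a ^ 2 = q * b ^ 2 + c * c by linear_combination hc]
      exact h3.add_mul_left_left _
    exact h4.of_isCoprime_of_dvd_left ⟨a, by ring⟩
  have hD : (p * q) % 4 = 1 := by simp [Nat.mul_mod, hp, hq]
  have hmul (n : ℤ) : jacobiSym n q * jacobiSym n p = jacobiSym n (p * q) := by
    rw [jacobiSym.mul_right, mul_comm]
  rcases h1 with ⟨hce, hb, h1⟩ | ⟨hco, -, h1⟩
  · rcases h2 with ⟨-, -, h2⟩ | ⟨hco, -, -⟩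
    swap
    · exact absurd hce (Int.not_even_iff_odd.mpr hco)
    rw [h1, h2, hmul]
    refine jacobiSym_two_mul_eq_one_of_dvd hD (by rintro rfl; simp at hpc) hce ?_ hdvd
      hcb.symm hcop
    -- If `4 ∣ c`, then `p ≡ q` mod `8` since `a` and `b` are odd, hence `p * q ≡ 1` mod `8`.
    rintro ⟨C, rfl⟩
    obtain ⟨A, hA⟩ := Int.eight_dvd_sq_sub_one_of_odd ha
    obtain ⟨B, hB⟩ := Int.eight_dvd_sq_sub_one_of_odd hb
    have hpq8 : (p : ℤ) = q + 8 * (2 * C ^ 2 - p * A + q * B) := by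
      linear_combination hc - p * hA + q * hB
    have hmod : p % 8 = q % 8 := by omega
    have hq8 : q % 8 = 1 ∨ q % 8 = 5 := by omega
    rcases hq8 with h8 | h8 <;> simp [Nat.mul_mod, hmod, h8]
  · rcases h2 with ⟨hce, -, -⟩ | ⟨-, -, h2⟩
    · exact absurd hce (Int.not_even_iff_odd.mpr hco)
    rw [h1, h2, hmul]
    exact jacobiSym_eq_one_of_dvd hD hco hdvd hcb.symm hcop

theorem quarticSymbol_eq_one_of_sub_eq_one {p q : ℕ} [Fact p.Prime] [Fact q.Prime]
    (hne : p ≠ q) (hp : p % 4 = 1) (hq : q % 4 = 1) {a b : ℤ} (h : p * a ^ 2 - q * b ^ 2 = 1) :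
    quarticSymbol p q = 1 := by
  have hab : IsCoprime a b := ⟨p * a, -(q * b), by linear_combination h⟩
  rcases (quarticSymbol_eq_of_conic (c := 1) hne hp hq (by simpa using h) hab).2 with
    ⟨h1, -, -⟩ | ⟨-, -, h1⟩
  · exact absurd h1 (by decide)
  · rw [h1, jacobiSym.one_left]

/-! ### Descent from the fundamental solution of the Pell equation -/

theorem exists_sq_of_mul_eq {d e m n y : ℤ} (hd : 0 < d) (he : 0 < e) (hm : 0 ≤ m) (hn : 0 ≤ n)
    (h : IsCoprime (d * m) (e * n)) (hy : d * m * (e * n) = d * e * y ^ 2) :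
    ∃ s t, m = s ^ 2 ∧ n = t ^ 2 := by
  have hcop : IsCoprime m n := h.of_mul_left_right.of_mul_right_right
  have hmn : m * n = y ^ 2 := by
    apply mul_left_cancel₀ (mul_pos hd he).ne'
    linear_combination hy
  have key {u v : ℤ} (hu : 0 ≤ u) (huv : IsCoprime u v) (h : u * v = y ^ 2) : ∃ s, u = s ^ 2 := by
    obtain ⟨s, hs | hs⟩ := Int.sq_of_isCoprime huv h
    · exact ⟨s, hs⟩
    -- `u = -s ^ 2` together with `0 ≤ u` leaves only `u = 0`.
    · exact ⟨0, by nlinarith [sq_nonneg s]⟩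
  obtain ⟨s, hs⟩ := key hm hcop hmn
  obtain ⟨t, ht⟩ := key hn hcop.symm (by rw [mul_comm, hmn])
  exact ⟨s, t, hs, ht⟩

/-- For the fundamental solution of `x ^ 2 - p * q * y ^ 2 = 1`, with `x = 2 * X + 1` and `y = 2 * Y`,
one has `(X + 1) * X = p * q * Y ^ 2` with coprime factors. Distributing `p` and `q` over the two
factors gives four cases, one of which contradicts minimality. -/
theorem exists_solution_of_prime_mul_prime {p q : ℕ} [hp' : Fact p.Prime] [hq' : Fact q.Prime]
    (hne : p ≠ q) (hp : p % 4 = 1) (hq : q % 4 = 1) :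
    (∃ x y : ℤ, x ^ 2 - p * q * y ^ 2 = -1) ∨ (∃ a b : ℤ, p * a ^ 2 - q * b ^ 2 = 1) ∨
      ∃ a b : ℤ, q * a ^ 2 - p * b ^ 2 = 1 := by
  have hp0 : (0 : ℤ) < p := by exact_mod_cast hp'.out.pos
  have hq0 : (0 : ℤ) < q := by exact_mod_cast hq'.out.pos
  have hpp := Nat.prime_iff_prime_int.mp hp'.out
  have hqp := Nat.prime_iff_prime_int.mp hq'.out
  have cop : IsCoprime (p : ℤ) q :=
    Nat.isCoprime_iff_coprime.mpr ((Nat.coprime_primes hp'.out hq'.out).mpr hne)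
  have hns : ¬ IsSquare ((p : ℤ) * q) := by
    rintro ⟨r, hr⟩
    obtain ⟨s, hs⟩ : (p : ℤ) ∣ r := hpp.dvd_of_dvd_pow (n := 2) ⟨q, by rw [hr]; ring⟩
    have : (q : ℤ) = p * s ^ 2 := by
      apply mul_left_cancel₀ hp0.ne'; rw [hr, hs]; ring
    exact hpp.not_isUnit (cop.isUnit_of_dvd' dvd_rfl ⟨_, this⟩)
  obtain ⟨f, hf⟩ := Pell.IsFundamental.exists_of_not_isSquare (mul_pos hp0 hq0) hns
  obtain ⟨hx1, hy0, hmin⟩ := hf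
  have hprop := f.prop
  set x := f.x with hx
  set y := f.y with hy
  obtain ⟨N, hN⟩ : ∃ N : ℤ, (p : ℤ) * q = 4 * N + 1 := by
    refine ⟨((p * q : ℕ) : ℤ) / 4, ?_⟩
    have : (p * q) % 4 = 1 := by simp [Nat.mul_mod, hp, hq]
    rw [← Nat.cast_mul]; omega
  obtain ⟨X, Y, hX, hY⟩ : ∃ X Y : ℤ, x = 2 * X + 1 ∧ y = 2 * Y := by
    rcases Int.even_or_odd' x with ⟨X, h1 | h1⟩ <;> rcases Int.even_or_odd' y with ⟨Y, h2 | h2⟩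
    · rw [hN, h1, h2] at hprop; ring_nf at hprop; omega
    · rw [hN, h1, h2] at hprop; ring_nf at hprop; omega
    · exact ⟨X, Y, h1, h2⟩
    · rw [hN, h1, h2] at hprop; ring_nf at hprop; omega
  have hX0 : 0 < X := by omega
  have hprod : (X + 1) * X = p * q * Y ^ 2 := by
    rw [hX, hY] at hprop; linarith
  have hcop : IsCoprime (X + 1) X := ⟨1, -1, by ring⟩
  have factor {d m : ℤ} (hd : 0 < d) (h : 0 < d * m) : 0 ≤ m := (pos_of_mul_pos_right h hd.le).le
  have hpd : (p : ℤ) ∣ (X + 1) * X := ⟨q * Y ^ 2, by rw [hprod]; ring⟩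
  have hqd : (q : ℤ) ∣ (X + 1) * X := ⟨p * Y ^ 2, by rw [hprod]; ring⟩
  have hX1 : 0 < X + 1 := by omega
  rcases hpp.dvd_or_dvd hpd with hp1 | hp1 <;> rcases hqp.dvd_or_dvd hqd with hq1 | hq1
  · obtain ⟨m, hm⟩ := cop.mul_dvd hp1 hq1
    obtain ⟨s, t, hs, ht⟩ := exists_sq_of_mul_eq (d := p * q) (e := 1) (m := m) (n := X) (y := Y)
      (mul_pos hp0 hq0) one_pos (factor (mul_pos hp0 hq0) (hm ▸ hX1)) hX0.le
      (by rwa [← hm, one_mul]) (by rw [← hm]; linarith)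
    exact Or.inl ⟨t, s, by rw [← hs, ← ht]; linarith⟩
  · obtain ⟨m, hm⟩ := hp1
    obtain ⟨n, hn⟩ := hq1
    obtain ⟨s, t, hs, ht⟩ := exists_sq_of_mul_eq (d := p) (e := q) (m := m) (n := n) (y := Y)
      hp0 hq0 (factor hp0 (hm ▸ hX1)) (factor hq0 (hn ▸ hX0))
      (by rwa [← hm, ← hn]) (by rw [← hm, ← hn]; exact hprod)
    exact Or.inr (Or.inl ⟨s, t, by rw [← hs, ← ht]; linarith⟩)
  · obtain ⟨m, hm⟩ := hq1
    obtain ⟨n, hn⟩ := hp1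
    obtain ⟨s, t, hs, ht⟩ := exists_sq_of_mul_eq (d := q) (e := p) (m := m) (n := n) (y := Y)
      hq0 hp0 (factor hq0 (hm ▸ hX1)) (factor hp0 (hn ▸ hX0))
      (by rwa [← hm, ← hn]) (by rw [← hm, ← hn]; linarith)
    exact Or.inr (Or.inr ⟨s, t, by rw [← hs, ← ht]; linarith⟩)
  -- Here `X + 1 = s ^ 2` and `X = p * q * t ^ 2`, so `(|s|, t)` is a smaller solution.
  · exfalso
    obtain ⟨n, hn⟩ := cop.mul_dvd hp1 hq1
    obtain ⟨s, t, hs, ht⟩ := exists_sq_of_mul_eq (d := 1) (e := p * q) (m := X + 1) (n := n) (y := Y)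
      one_pos (mul_pos hp0 hq0) hX1.le (factor (mul_pos hp0 hq0) (hn ▸ hX0))
      (by rwa [← hn, one_mul]) (by rw [← hn]; linarith)
    have hs2 : |s| ^ 2 = X + 1 := by rw [sq_abs, hs]
    have hs1 : 1 < |s| := by nlinarith [abs_nonneg s]
    have hle : x ≤ |s| := hmin (b := Pell.Solution₁.mk |s| t (by rw [hs2, ← ht]; linarith)) hs1
    nlinarith

/-! ### The equations `x ^ 2 - p * q * y ^ 2 = -1` and `x ^ 2 - p * q * y ^ 2 = p` -/

theorem corollary1p3 (p q : ℕ) [Fact p.Prime] [Fact q.Prime]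
    (hpq : p ≠ q) (hp : p % 4 = 1) (hq : q % 4 = 1)
    (hleg : legendreSym p (q : ℤ) = 1)
    (hquart : quarticSymbol q (p : ℤ) * quarticSymbol p (q : ℤ) = -1) :
    (¬ ∃ x y : ℤ, x ^ 2 - (p : ℤ) * (q : ℤ) * y ^ 2 = -1) ∧
    ((∃ x y : ℤ, x ^ 2 - (p : ℤ) * (q : ℤ) * y ^ 2 = (p : ℤ)) ↔
      quarticSymbol p (q : ℤ) = 1) := by
  have hqp : IsSquare (q : ZMod p) :=
    (legendreSym.eq_one_iff' p (ZMod.prime_ne_zero p q hpq)).mp hleg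
  have hpq' : IsSquare (p : ZMod q) :=
    (ZMod.exists_sq_eq_prime_iff_of_mod_four_eq_one hp (by rintro rfl; omega)).mp hqp
  have hneg : ¬ ∃ x y : ℤ, x ^ 2 - (p : ℤ) * (q : ℤ) * y ^ 2 = -1 := by
    rintro ⟨x, y, h⟩
    rw [quarticSymbol_mul_eq_one_of_neg_pell hpq hp hq hqp hpq' h] at hquart
    omega
  refine ⟨hneg, ?_, fun h1 => ?_⟩
  · rintro ⟨x, y, h⟩
    have hp' := Nat.prime_iff_prime_int.mp (Fact.out : p.Prime)
    obtain ⟨a, rfl⟩ : (p : ℤ) ∣ x :=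
      hp'.dvd_of_dvd_pow (n := 2) ⟨1 + q * y ^ 2, by linear_combination h⟩
    refine quarticSymbol_eq_one_of_sub_eq_one hpq hp hq (a := a) (b := y) ?_
    apply mul_left_cancel₀ hp'.ne_zero
    linear_combination h
  · rcases exists_solution_of_prime_mul_prime hpq hp hq with h | ⟨a, b, h⟩ | ⟨a, b, h⟩
    · exact absurd h hneg
    · exact ⟨p * a, b, by linear_combination (p : ℤ) * h⟩
    · rw [h1, quarticSymbol_eq_one_of_sub_eq_one hpq.symm hq hp h] at hquart
      omega
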